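/- **Setting.** A (causal, time-invariant) input-output process with input alphabet $\mathcal X$ and output alphabet $\mathcal Y$ prescribes, for every semi-infinite joint past $z$ of inputs and outputs and every present input $x$, the distribution $\Pr(y\mid x,z)$ of the next output. Its causal states are the classes of joint pasts with the same conditional probabilities of all future output words given the future inputs; $T^{(y|x)}_{ij}$ is the probability that in causal state $i$ and on input $x$ the output is $y$ and the next causal state is $j$. When the process is driven by an IID input with symbol law $\nu$, a stationary distribution is a probability vector $\pi$ on the causal states with $\sum_i\pi_i\sum_{x,y}\nu(x)T^{(y|x)}_{ij}=\pi_j$. The classical complexity is $C=-\sum_i\pi_i\log\pi_i$. A quantum model consists of finite-dimensional unit vectors $|s_i\rangle$, one for each causal state, unit vectors $|\psi_{i,x,y}\rangle$ of an ancilla, and a unitary $U$ with $$U\,|s_i\rangle|x\rangle|0\rangle|0\rangle=\sum_{y}\sum_j\sqrt{T^{(y|x)}_{ij}}\;|s_j\rangle|x\rangle|y\rangle|\psi_{i,x,y}\rangle\qquad\text{for all } i,x .$$ Its complexity is the von Neumann entropy of $\rho=\sum_i\pi_i|s_i\rangle\langle s_i|$, and the optimal quantum complexity $Q$ is the infimum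 of this entropy over all quantum models. **Statement.** There is an input-output process with two causal states whose classical and optimal quantum complexities differ, yet which orders the classical and the quantum complexities of every pair of biased-coin inputs in the same way. Explicitly, let $p,q\in(0,1)$ with $p+q\ne1$, and let $\mathcal X=\mathcal Y=\{0,1\}$. On input $1$ the process always outputs $0$. On input $0$, it outputs $1$ with probability $p$ (and $0$ with probability $1-p$) if its last output was $0$, and it outputs $0$ with probability $q$ (and $1$ with probability $1-q$) if its last output was $1$. For $r\in[0,1]$ the biased coin with bias $r$ is the IID input with $\Pr(0)=r$, $\Pr(1)=1-r$. Then: 1. the process has exactly two causal states; 2. for every $r\in[0,1]$ there is exactly one stationary distribution; let $C_r$ and $Q_r$ be the classical and the optimal quantum complexity at it; 3. one and the same quantum model attains the infimum $Q_r$ for all $r\in[0,1]$; 4. $Q_r<C_r$ for every $r\in(0,1]$; 5. for all $r,r'\in[0,1]$: $\;C_r<C_{r'}$ if and only if $Q_r<Q_{r'}$. -/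

import Mathlib

noncomputable section

/-- Semi-infinite joint pasts of inputs and outputs; `z 0` is the most recent pair,
`z 1` the pair before it, and so on. -/
def JointPast (X Y : Type) : Type := ℕ → X × Y

namespace JointPast

variable {X Y : Type}

/-- The past one time step later, after input `x` was received and output `y` was emitted. -/
def extend (z : JointPast X Y) (x : X) (y : Y) : JointPast X Y
  | 0 => (x, y)
  | n + 1 => z n

end JointPast

/-- A causal (anticipation-free), time-invariant input-output process, given by its behaviour on
semi-infinite joint pasts: `prob z x y` is the probability that the next output is `y`, given the
joint past `z` and the present input `x`. -/
structure IOProcess (X Y : Type) [Fintype Y] where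
  prob : JointPast X Y → X → Y → ℝ
  prob_nonneg : ∀ z x y, 0 ≤ prob z x y
  prob_sum : ∀ z x, ∑ y, prob z x y = 1

namespace IOProcess

variable {X Y : Type} [Fintype Y]

/-- `A.wordProb z [(x₀,y₀),…,(x_{L-1},y_{L-1})]` is the probability of the future output word
`y₀ … y_{L-1}`, given the future inputs `x₀ … x_{L-1}` and the joint past `z`. -/
def wordProb (A : IOProcess X Y) : JointPast X Y → List (X × Y) → ℝ
  | _, [] => 1
  | z, (x, y) :: w => A.prob z x y * A.wordProb (z.extend x y) w

/-- Causal equivalence of joint pasts: the same conditional future outputs given future inputs. -/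
def causalSetoid (A : IOProcess X Y) : Setoid (JointPast X Y) where
  r z z' := ∀ w, A.wordProb z w = A.wordProb z' w
  iseqv := ⟨fun _ _ => rfl, fun h w => (h w).symm, fun h h' w => (h w).trans (h' w)⟩

/-- The causal states, i.e. the states of the ε-transducer of `A`. -/
def CausalState (A : IOProcess X Y) : Type := Quotient A.causalSetoid

/-- The causal state of a joint past. -/
def stateOf (A : IOProcess X Y) (z : JointPast X Y) : A.CausalState :=
  Quotient.mk A.causalSetoid z

theorem prob_eq_of_equiv (A : IOProcess X Y) {z z' : JointPast X Y}
    (h : A.causalSetoid.r z z') (x : X) (y : Y) : A.prob z x y = A.prob z' x y := by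
  simpa [wordProb] using h [(x, y)]

theorem stateOf_extend_eq (A : IOProcess X Y) {z z' : JointPast X Y}
    (h : A.causalSetoid.r z z') (x : X) (y : Y) (hz : A.prob z x y ≠ 0) :
    A.stateOf (z.extend x y) = A.stateOf (z'.extend x y) := by
  refine Quotient.sound (s := A.causalSetoid) fun w => ?_
  have h1 := h ((x, y) :: w)
  simp only [wordProb, ← A.prob_eq_of_equiv h x y] at h1
  exact mul_left_cancel₀ hz h1

open scoped Classical in
/-- The ε-transducer's transition matrices: `A.transition x y i j` is the probability that,
in causal state `i` and on input `x`, the output is `y` and the next causal state is `j`. -/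
def transition (A : IOProcess X Y) (x : X) (y : Y) (i j : A.CausalState) : ℝ :=
  Quotient.lift (s := A.causalSetoid)
    (fun z => if A.stateOf (z.extend x y) = j then A.prob z x y else 0)
    (by
      intro z z' h
      by_cases hz : A.prob z x y = 0
      · simp [hz, ← A.prob_eq_of_equiv h x y]
      · simp [A.stateOf_extend_eq h x y hz, A.prob_eq_of_equiv h x y]) i

/-- `π` is a stationary distribution over the causal states when `A` is driven by the IID input
process whose symbols have law `ν`: the present input is independent of the joint past. -/
def IsStationary [Fintype X] (A : IOProcess X Y) [Fintype A.CausalState]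
    (ν : X → ℝ) (π : A.CausalState → ℝ) : Prop :=
  π ∈ stdSimplex ℝ A.CausalState ∧
    ∀ j, ∑ i, π i * ∑ x, ν x * ∑ y, A.transition x y i j = π j

/-- Classical (statistical) complexity: Shannon entropy of the distribution `π` over the causal
states. -/
def classicalComplexity (A : IOProcess X Y) [Fintype A.CausalState] (π : A.CausalState → ℝ) : ℝ :=
  ∑ i, Real.negMulLog (π i)

open scoped Classical in
/-- The product vector `|s⟩|x⟩|y⟩|ψ⟩` on memory, input, output and ancilla registers. -/
def productVec {m k : ℕ} (s : EuclideanSpace ℂ (Fin m)) (x : X) (y : Y)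
    (ψ : EuclideanSpace ℂ (Fin k)) : Fin m × X × Y × Fin k → ℂ :=
  fun a => s a.1 * (if a.2.1 = x then 1 else 0) * (if a.2.2.1 = y then 1 else 0) * ψ a.2.2.2

/-- A faithful quantum model of `A`: pure memory states `|s_i⟩`, one for each causal state, and a
unitary with
`U |s_i⟩|x⟩|0⟩|0⟩ = ∑_y √(T^{(y|x)}_{ij}) |s_j⟩|x⟩|y⟩|ψ_{i,x,y}⟩`,
where `j` is the causal state that follows `i` on input `x` and output `y`, and the `|ψ_{i,x,y}⟩`
are discarded. The output is read off by measuring the third register. -/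
structure QuantumModel [Fintype X] [DecidableEq X] [DecidableEq Y]
    (A : IOProcess X Y) [Fintype A.CausalState] where
  memDim : ℕ
  ancDim : ℕ
  state : A.CausalState → EuclideanSpace ℂ (Fin memDim)
  state_norm : ∀ i, ‖state i‖ = 1
  blankOut : Y
  blankAnc : Fin ancDim
  junk : A.CausalState → X → Y → EuclideanSpace ℂ (Fin ancDim)
  junk_norm : ∀ i x y, ‖junk i x y‖ = 1
  U : Matrix.unitaryGroup (Fin memDim × X × Y × Fin ancDim) ℂ
  evolve : ∀ i x,
    Matrix.mulVec (U : Matrix (Fin memDim × X × Y × Fin ancDim) (Fin memDim × X × Y × Fin ancDim) ℂ)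
      (productVec (state i) x blankOut (EuclideanSpace.single blankAnc 1)) =
    ∑ y, ∑ j, ((Real.sqrt (A.transition x y i j) : ℝ) : ℂ) •
      productVec (state j) x y (junk i x y)

namespace QuantumModel

variable [Fintype X] [DecidableEq X] [DecidableEq Y] {A : IOProcess X Y} [Fintype A.CausalState]

/-- The average memory state `ρ = ∑_i π_i |s_i⟩⟨s_i|`. -/
def memoryState (M : A.QuantumModel) (π : A.CausalState → ℝ) :
    Matrix (Fin M.memDim) (Fin M.memDim) ℂ :=
  ∑ i, ((π i : ℝ) : ℂ) • Matrix.of fun a b => M.state i a * star (M.state i b)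

theorem memoryState_isHermitian (M : A.QuantumModel) (π : A.CausalState → ℝ) :
    (M.memoryState π).IsHermitian := by
  ext a b
  simp [memoryState, Matrix.sum_apply, mul_comm]

/-- Complexity of a quantum model: von Neumann entropy of its average memory state. -/
def complexity (M : A.QuantumModel) (π : A.CausalState → ℝ) : ℝ :=
  ∑ a, Real.negMulLog ((M.memoryState_isHermitian π).eigenvalues a)

end QuantumModel

/-- Quantum complexity of `A` at the distribution `π` over the causal states: the optimum over all
faithful quantum models. -/
def quantumComplexity [Fintype X] [DecidableEq X] [DecidableEq Y]
    (A : IOProcess X Y) [Fintype A.CausalState] (π : A.CausalState → ℝ) : ℝ :=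
  ⨅ M : A.QuantumModel, M.complexity π

end IOProcess

/-- The single-symbol law of the biased coin process with bias `r`: symbol `0` has probability `r`,
symbol `1` has probability `1 - r`. -/
def biasedCoin (r : ℝ) : Fin 2 → ℝ := ![r, 1 - r]

/-- On input `1` the output is `0`. On input `0` the output is `1` with probability `p` if the last
output was `0`, and the output is `0` with probability `q` if the last output was `1`. -/
def labelProcess (p q : unitInterval) : IOProcess (Fin 2) (Fin 2) where
  prob z x y :=
    if x = 0 then
      (if (z 0).2 = 0 then ![1 - (p : ℝ), (p : ℝ)] y else ![(q : ℝ), 1 - (q : ℝ)] y)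
    else ![1, 0] y
  prob_nonneg z x y := by
    have := p.2.1; have := p.2.2; have := q.2.1; have := q.2.2
    split_ifs <;> fin_cases y <;> simp <;> linarith
  prob_sum z x := by split_ifs <;> simp

/-- The causal state of a past of `labelProcess p q` is determined by the last output. -/
theorem labelProcess_equiv (p q : unitInterval) {z z' : JointPast (Fin 2) (Fin 2)}
    (h : (z 0).2 = (z' 0).2) : (labelProcess p q).causalSetoid.r z z' := by
  intro w
  induction w generalizing z z' with
  | nil => rfl
  | cons a w ih =>
    obtain ⟨x, y⟩ := a
    have h1 : (labelProcess p q).prob z x y = (labelProcess p q).prob z' x y := by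
      simp only [labelProcess, h]
    have h2 := @ih (z.extend x y) (z'.extend x y) rfl
    simp only [IOProcess.wordProb, h1, h2]

instance labelProcess_finite (p q : unitInterval) : Finite (labelProcess p q).CausalState := by
  refine Finite.of_surjective
    (fun y : Fin 2 => (labelProcess p q).stateOf (fun _ => ((0 : Fin 2), y))) ?_
  intro s
  obtain ⟨z, rfl⟩ := Quotient.exists_rep s
  exact ⟨(z 0).2, Quotient.sound (s := (labelProcess p q).causalSetoid)
    (labelProcess_equiv p q rfl)⟩

instance labelProcess_fintype (p q : unitInterval) : Fintype (labelProcess p q).CausalState :=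
  Fintype.ofFinite _

end

/-! The last output determines the causal state, and `p + q ≠ 1` keeps the two labels inequivalent.
A mixture of two pure states with weights π₀, π₁ has the same nonzero spectrum as its weighted 2 × 2
Gram matrix, which has trace 1 and determinant π₀π₁(1 - |⟨s₀|s₁⟩|²). Its entropy is therefore a
function of this determinant alone (`sum_negMulLog_eigenvalues_mixture`), strictly increasing on [0,
1/4] (`Real.strictMonoOn_entropyOfDet`). The classical complexity is the case of overlap 0.

Minimizing the quantum complexity thus means maximizing the overlap, whatever π is. Unitarity on
input 0 bounds the overlap by `maxOverlap` (`norm_inner_state_le`), and `optimalModel` attains the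
bound. With t = π₀π₁ and c = 1 - `maxOverlap`², the complexities C and Q are one increasing function
evaluated at t and at c t. Since c is a positive constant, both order the inputs as t does; since c
< 1, Q < C whenever t > 0. -/

/-! ### Entropy of a mixture of two pure states -/

open Polynomial in
/-- For a Hermitian product `A * B`, a sum over the eigenvalues of a function vanishing at `0`
can be read off from the characteristic polynomial of `B * A`. -/
theorem Matrix.IsHermitian.sum_eigenvalues_eq_of_eq_mul {m n : Type*} [Fintype m] [DecidableEq m]
    [Fintype n] [DecidableEq n] {ρ : Matrix m m ℂ} (hρ : ρ.IsHermitian)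
    {A : Matrix m n ℂ} {B : Matrix n m ℂ} (h : ρ = A * B) (f : ℝ → ℝ) (hf : f 0 = 0) :
    ∑ i, f (hρ.eigenvalues i) = ((B * A).charpoly.roots.map fun z => f z.re).sum := by
  -- The characteristic polynomials of `A * B` and `B * A` agree up to powers of `X`; the extra zero
  -- roots contribute `f 0 = 0`.
  have h1 := congrArg (fun P : ℂ[X] => (P.roots.map fun z => f z.re).sum)
    (Matrix.charpoly_mul_comm' A B)
  have hX (k : ℕ) : (X ^ k : ℂ[X]) ≠ 0 := pow_ne_zero _ X_ne_zero
  simp only [Polynomial.roots_mul (mul_ne_zero (hX _) (Matrix.charpoly_monic _).ne_zero),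
    Polynomial.roots_X_pow, Multiset.map_add, Multiset.sum_add, Multiset.map_nsmul,
    Multiset.sum_nsmul, Multiset.map_singleton, Multiset.sum_singleton, Complex.zero_re, hf,
    smul_zero, zero_add] at h1
  rw [← h1, ← h, hρ.roots_charpoly_eq_eigenvalues]
  simp

open Polynomial in
theorem Matrix.charpoly_fin_two_eq_of_trace_of_det {R : Type*} [CommRing R]
    {G : Matrix (Fin 2) (Fin 2) R} {a b : R} (ht : G 0 0 + G 1 1 = a + b)
    (hd : G 0 0 * G 1 1 - G 0 1 * G 1 0 = a * b) :
    G.charpoly = (X - C a) * (X - C b) := by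
  have ht' := congrArg (C : R → R[X]) ht
  have hd' := congrArg (C : R → R[X]) hd
  simp only [map_add, map_sub, map_mul] at ht' hd'
  simp only [Matrix.charpoly, Matrix.det_fin_two, Matrix.charmatrix_apply_eq, ne_eq, zero_ne_one,
    one_ne_zero, not_false_eq_true, Matrix.charmatrix_apply_ne]
  linear_combination (-X) * ht' + hd'

namespace Real

/-- Shannon entropy of the spectrum of a `2 × 2` density matrix, as a function of its
determinant. -/
noncomputable def entropyOfDet (d : ℝ) : ℝ := binEntropy ((1 - √(1 - 4 * d)) / 2)

/-- The smaller root of x(1 - x) = d increases with d and stays in [0, 1/2], where the binary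
entropy increases. -/
theorem strictMonoOn_entropyOfDet : StrictMonoOn entropyOfDet (Set.Icc 0 4⁻¹) := by
  intro d hd d' hd' h
  obtain ⟨h0, h1⟩ := hd
  obtain ⟨h0', h1'⟩ := hd'
  have hlt : √(1 - 4 * d') < √(1 - 4 * d) := sqrt_lt_sqrt (by linarith) (by linarith)
  have hle : √(1 - 4 * d) ≤ 1 := sqrt_le_one.2 (by linarith)
  have := sqrt_nonneg (1 - 4 * d')
  refine binEntropy_strictMonoOn ⟨?_, ?_⟩ ⟨?_, ?_⟩ ?_ <;> linarith

theorem entropyOfDet_mul_one_sub (x : ℝ) : entropyOfDet (x * (1 - x)) = binEntropy x := by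
  have h : 1 - 4 * (x * (1 - x)) = (1 - 2 * x) ^ 2 := by ring
  rw [entropyOfDet, h, sqrt_sq_eq_abs]
  rcases abs_cases (1 - 2 * x) with ⟨h, -⟩ | ⟨h, -⟩ <;> rw [h]
  · congr 1; ring
  · rw [← binEntropy_one_sub]; congr 1; ring

end Real

/-- The von Neumann entropy of a mixture of two pure states. -/
theorem sum_negMulLog_eigenvalues_mixture {m : ℕ} {ρ : Matrix (Fin m) (Fin m) ℂ}
    (hρ : ρ.IsHermitian) (s : Fin 2 → EuclideanSpace ℂ (Fin m)) (hs : ∀ i, ‖s i‖ = 1)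
    (w : Fin 2 → ℝ) (hw : ∀ i, 0 ≤ w i) (hw1 : w 0 + w 1 = 1)
    (h : ρ = ∑ i, ((w i : ℝ) : ℂ) • Matrix.of fun a b => s i a * star (s i b)) :
    ∑ a, Real.negMulLog (hρ.eigenvalues a) =
      Real.entropyOfDet (w 0 * w 1 * (1 - ‖inner ℂ (s 0) (s 1)‖ ^ 2)) := by
  set d := w 0 * w 1 * (1 - ‖inner ℂ (s 0) (s 1)‖ ^ 2) with hd
  set l := (1 - √(1 - 4 * d)) / 2 with hl
  have h4 : 4 * d ≤ 1 := by
    have h1 := mul_nonneg (mul_nonneg (hw 0) (hw 1)) (sq_nonneg ‖inner ℂ (s 0) (s 1)‖)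
    have h2 : 4 * (w 0 * w 1) ≤ 1 := by
      rw [eq_sub_of_add_eq hw1]; nlinarith [sq_nonneg (1 - 2 * w 1)]
    rw [hd]; linarith
  have hsq : √(1 - 4 * d) ^ 2 = 1 - 4 * d := Real.sq_sqrt (by linarith)
  have hdet : l * (1 - l) = d := by rw [hl]; linear_combination -hsq / 4
  -- The weights all go into `B`, so that `B * A` is the weighted Gram matrix, with eigenvalues `l`
  -- and `1 - l`.
  let A : Matrix (Fin m) (Fin 2) ℂ := Matrix.of fun a i => s i a
  let B : Matrix (Fin 2) (Fin m) ℂ := Matrix.of fun i b => (w i : ℂ) * star (s i b)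
  have hAB : ρ = A * B := by
    rw [h]; ext a b
    simp only [Matrix.sum_apply, Matrix.smul_apply, Matrix.of_apply, Matrix.mul_apply, A, B,
      smul_eq_mul]
    exact Finset.sum_congr rfl fun _ _ => by ring
  have hG (i j) : (B * A) i j = w i * inner ℂ (s i) (s j) := by
    simp only [Matrix.mul_apply, Matrix.of_apply, A, B, PiLp.inner_apply, Finset.mul_sum,
      RCLike.inner_apply]
    exact Finset.sum_congr rfl fun _ _ => by simp; ring
  have hself (i) : inner ℂ (s i) (s i) = (1 : ℂ) := by simp [inner_self_eq_norm_sq_to_K, hs]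
  rw [hρ.sum_eigenvalues_eq_of_eq_mul hAB _ Real.negMulLog_zero,
    Matrix.charpoly_fin_two_eq_of_trace_of_det (a := (l : ℂ)) (b := ((1 - l : ℝ) : ℂ)),
    Polynomial.roots_mul, Polynomial.roots_X_sub_C, Polynomial.roots_X_sub_C]
  · simp [Real.entropyOfDet, Real.binEntropy_eq_negMulLog_add_negMulLog_one_sub, hl]
  · exact mul_ne_zero (Polynomial.X_sub_C_ne_zero _) (Polynomial.X_sub_C_ne_zero _)
  · rw [hG, hG, hself, hself]; push_cast
    have : (w 0 + w 1 : ℂ) = 1 := by exact_mod_cast hw1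
    linear_combination this
  · have hn : inner ℂ (s 0) (s 1) * inner ℂ (s 1) (s 0) = ((‖inner ℂ (s 0) (s 1)‖ ^ 2 : ℝ) : ℂ) := by
      rw [← inner_conj_symm (s 1) (s 0), RCLike.mul_conj]; push_cast; rfl
    rw [hG, hG, hG, hG, hself, hself, ← Complex.ofReal_mul, hdet, hd]; push_cast at hn ⊢
    linear_combination (-(w 0 : ℂ) * w 1) * hn
-- Causal states and stationary distributions
noncomputable section

/-- The probability of output `y` on input `x` when the last output was `a`. -/
def labelProb (p q : unitInterval) (a x y : Fin 2) : ℝ :=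
  if x = 0 then (if a = 0 then ![1 - (p : ℝ), (p : ℝ)] y else ![(q : ℝ), 1 - (q : ℝ)] y)
  else ![1, 0] y

namespace labelProcess

variable {p q : unitInterval}

/-- The causal states of `labelProcess p q`, labelled by the last output. -/
def causalStateEquiv (hpq : (p : ℝ) + (q : ℝ) ≠ 1) : Fin 2 ≃ (labelProcess p q).CausalState :=
  Equiv.ofBijective (fun y => (labelProcess p q).stateOf fun _ => (0, y)) <| by
    constructor
    · have key : (labelProcess p q).stateOf (fun _ => (0, 0)) ≠
          (labelProcess p q).stateOf fun _ => (0, 1) := fun h => by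
        -- Output 0 on input 0 has probability `1 - p` after a 0 and `q` after a 1.
        have h1 := (labelProcess p q).prob_eq_of_equiv (Quotient.exact h) 0 0
        simp only [labelProcess, if_true, one_ne_zero, if_false, Matrix.cons_val_zero] at h1
        exact hpq (by linarith)
      intro a b h
      fin_cases a <;> fin_cases b
      · rfl
      · exact (key h).elim
      · exact (key h.symm).elim
      · rfl
    · intro s
      obtain ⟨z, rfl⟩ := Quotient.exists_rep s
      exact ⟨(z 0).2, Quotient.sound (s := (labelProcess p q).causalSetoid)
        (labelProcess_equiv p q rfl)⟩

theorem stateOf_eq (hpq : (p : ℝ) + (q : ℝ) ≠ 1) (z : JointPast (Fin 2) (Fin 2)) :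
    (labelProcess p q).stateOf z = causalStateEquiv hpq (z 0).2 :=
  Quotient.sound (s := (labelProcess p q).causalSetoid) (labelProcess_equiv p q rfl)

open scoped Classical in
theorem transition_eq (hpq : (p : ℝ) + (q : ℝ) ≠ 1) (x y a b : Fin 2) :
    (labelProcess p q).transition x y (causalStateEquiv hpq a) (causalStateEquiv hpq b) =
      if y = b then labelProb p q a x y else 0 := by
  have h : (labelProcess p q).transition x y (causalStateEquiv hpq a) (causalStateEquiv hpq b) =
      if (labelProcess p q).stateOf (JointPast.extend (fun _ => (0, a)) x y) =
        causalStateEquiv hpq b then labelProb p q a x y else 0 := rfl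
  rw [h, stateOf_eq hpq]
  simp [JointPast.extend]

variable {r : ℝ} {π : (labelProcess p q).CausalState → ℝ}

theorem isStationary_iff (hpq : (p : ℝ) + (q : ℝ) ≠ 1) (hr : r ∈ Set.Icc (0 : ℝ) 1)
    (hq : 0 < (q : ℝ)) :
    (labelProcess p q).IsStationary (biasedCoin r) π ↔
      π (causalStateEquiv hpq 0) = (1 - r * (1 - q)) / (1 - r * (1 - p - q)) ∧
      π (causalStateEquiv hpq 1) = r * p / (1 - r * (1 - p - q)) := by
  obtain ⟨h0, h1⟩ := hr
  have hp0 := p.2.1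
  have hq1 := q.2.2
  have hrq : 0 < 1 - r * (1 - q) := by nlinarith
  have hrp : 0 ≤ r * p := mul_nonneg h0 hp0
  -- The denominator is the sum of the two numerators.
  have hden : 0 < 1 - r * (1 - p - q) := by linarith
  simp only [IOProcess.IsStationary, stdSimplex, Set.mem_ofPred_eq,
    ← (causalStateEquiv hpq).forall_congr_right, ← (causalStateEquiv hpq).sum_comp,
    transition_eq, Fin.forall_fin_two, Fin.sum_univ_two, labelProb, biasedCoin]
  simp only [if_true, one_ne_zero, zero_ne_one, if_false, Matrix.cons_val_zero,
    Matrix.cons_val_one, Matrix.cons_val_fin_one]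
  rw [eq_div_iff hden.ne', eq_div_iff hden.ne']
  generalize π (causalStateEquiv hpq 0) = u
  generalize π (causalStateEquiv hpq 1) = v
  constructor
  · rintro ⟨⟨-, h⟩, h2, h3⟩
    obtain rfl : u = 1 - v := by linarith
    constructor <;> linarith
  · rintro ⟨hu, hv⟩
    have huv : u + v = 1 := mul_right_cancel₀ hden.ne' (by linarith)
    obtain rfl : u = 1 - v := by linarith
    refine ⟨⟨⟨?_, ?_⟩, huv⟩, ?_, ?_⟩
    · exact (pos_of_mul_pos_left (by rw [hu]; exact hrq) hden.le).le
    · exact nonneg_of_mul_nonneg_left (by rw [hv]; exact hrp) hden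
    · linarith
    · linarith

theorem existsUnique_isStationary (hpq : (p : ℝ) + (q : ℝ) ≠ 1) (hr : r ∈ Set.Icc (0 : ℝ) 1)
    (hq : 0 < (q : ℝ)) :
    ∃! π : (labelProcess p q).CausalState → ℝ,
      (labelProcess p q).IsStationary (biasedCoin r) π := by
  refine ⟨![(1 - r * (1 - q)) / (1 - r * (1 - p - q)), r * p / (1 - r * (1 - p - q))] ∘
    (causalStateEquiv hpq).symm, ?_, fun π hπ => ?_⟩
  · simp [isStationary_iff hpq hr hq]
  · obtain ⟨h0, h1⟩ := (isStationary_iff hpq hr hq).1 hπ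
    funext i
    obtain ⟨a, rfl⟩ := (causalStateEquiv hpq).surjective i
    fin_cases a <;> simpa

theorem isStationary_pos (hpq : (p : ℝ) + (q : ℝ) ≠ 1) (hr : r ∈ Set.Ioc (0 : ℝ) 1)
    (hp : 0 < (p : ℝ)) (hq : 0 < (q : ℝ))
    (hπ : (labelProcess p q).IsStationary (biasedCoin r) π) (a : Fin 2) :
    0 < π (causalStateEquiv hpq a) := by
  obtain ⟨h0, h1⟩ := (isStationary_iff hpq ⟨hr.1.le, hr.2⟩ hq).1 hπ
  obtain ⟨hr0, hr1⟩ := hr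
  have hq1 := q.2.2
  have hrp : 0 < r * p := mul_pos hr0 hp
  have hrq : 0 < 1 - r * (1 - q) := by nlinarith
  have hden : 0 < 1 - r * (1 - p - q) := by linarith
  fin_cases a
  · exact h0 ▸ div_pos hrq hden
  · exact h1 ▸ div_pos hrp hden

theorem add_eq_one_of_mem_stdSimplex (hpq : (p : ℝ) + (q : ℝ) ≠ 1)
    (hπ : π ∈ stdSimplex ℝ (labelProcess p q).CausalState) :
    π (causalStateEquiv hpq 0) + π (causalStateEquiv hpq 1) = 1 := by
  have := hπ.2
  rwa [← (causalStateEquiv hpq).sum_comp, Fin.sum_univ_two] at this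

/-! ### Both complexities as entropies of a determinant -/

theorem classicalComplexity_eq (hpq : (p : ℝ) + (q : ℝ) ≠ 1)
    (hπ : π ∈ stdSimplex ℝ (labelProcess p q).CausalState) :
    (labelProcess p q).classicalComplexity π =
      Real.entropyOfDet (π (causalStateEquiv hpq 0) * π (causalStateEquiv hpq 1)) := by
  rw [← sub_eq_of_eq_add' (add_eq_one_of_mem_stdSimplex hpq hπ).symm,
    Real.entropyOfDet_mul_one_sub, Real.binEntropy_eq_negMulLog_add_negMulLog_one_sub,
    sub_eq_of_eq_add' (add_eq_one_of_mem_stdSimplex hpq hπ).symm, IOProcess.classicalComplexity,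
    ← (causalStateEquiv hpq).sum_comp, Fin.sum_univ_two]

theorem quantumModel_complexity_eq (hpq : (p : ℝ) + (q : ℝ) ≠ 1)
    (hπ : π ∈ stdSimplex ℝ (labelProcess p q).CausalState) (M : (labelProcess p q).QuantumModel) :
    M.complexity π =
      Real.entropyOfDet (π (causalStateEquiv hpq 0) * π (causalStateEquiv hpq 1) *
        (1 - ‖inner ℂ (M.state (causalStateEquiv hpq 0))
          (M.state (causalStateEquiv hpq 1))‖ ^ 2)) :=
  sum_negMulLog_eigenvalues_mixture _ (fun a => M.state (causalStateEquiv hpq a))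
    (fun _ => M.state_norm _) (fun a => π (causalStateEquiv hpq a)) (fun _ => hπ.1 _)
    (add_eq_one_of_mem_stdSimplex hpq hπ)
    ((causalStateEquiv hpq).sum_comp _).symm

/-! ### The overlap bound -/

/-- The largest overlap of the two memory states in a quantum model. -/
def maxOverlap (p q : unitInterval) : ℝ :=
  √(1 - p) * √q + √p * √(1 - q)

open IOProcess in
theorem star_productVec_dotProduct {X Y : Type} [Fintype X] [DecidableEq X] [Fintype Y]
    [DecidableEq Y] {m k : ℕ} (s s' : EuclideanSpace ℂ (Fin m))
    (x x' : X) (y y' : Y) (ψ ψ' : EuclideanSpace ℂ (Fin k)) :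
    star (productVec s x y ψ) ⬝ᵥ productVec s' x' y' ψ' =
      if x = x' ∧ y = y' then inner ℂ s s' * inner ℂ ψ ψ' else 0 := by
  have h : star (productVec s x y ψ) ⬝ᵥ productVec s' x' y' ψ' =
      (∑ a, star (s a) * s' a) * ((∑ b, if b = x ∧ b = x' then 1 else 0) *
        ((∑ c, if c = y ∧ c = y' then 1 else 0) * ∑ d, star (ψ d) * ψ' d)) := by
    rw [Finset.sum_mul_sum, Finset.sum_mul_sum, Finset.sum_mul_sum]
    simp only [dotProduct, Fintype.sum_prod_type, Finset.mul_sum, Pi.star_apply, productVec]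
    refine Finset.sum_congr rfl fun a _ => Finset.sum_congr rfl fun b _ =>
      Finset.sum_congr rfl fun c _ => Finset.sum_congr rfl fun d _ => ?_
    simp only [star_mul', apply_ite star, star_one, star_zero, ite_and]
    split_ifs <;> ring
  have hδ {Z : Type} [Fintype Z] [DecidableEq Z] (z z' : Z) :
      (∑ b, if b = z ∧ b = z' then (1 : ℂ) else 0) = if z = z' then 1 else 0 := by
    simp [ite_and]
  rw [h, hδ, hδ, ite_and]
  by_cases hx : x = x' <;> simp [PiLp.inner_apply, mul_comm, hx]

/-- The output is itself the label of the next causal state, so the inner sum in `evolve` has one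
term. -/
theorem sum_sqrt_transition_smul (hpq : (p : ℝ) + (q : ℝ) ≠ 1) {V : Type*} [AddCommGroup V]
    [Module ℂ V] (f : (labelProcess p q).CausalState → V) (x y a : Fin 2) :
    ∑ j, ((√((labelProcess p q).transition x y (causalStateEquiv hpq a) j) : ℝ) : ℂ) • f j =
      ((√(labelProb p q a x y) : ℝ) : ℂ) • f (causalStateEquiv hpq y) := by
  rw [← (causalStateEquiv hpq).sum_comp, Finset.sum_eq_single y]
  · rw [transition_eq, if_pos rfl]
  · intro b _ hb
    rw [transition_eq, if_neg hb.symm]; simp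
  · simp

theorem star_mulVec_dotProduct_mulVec {n : Type*} [Fintype n] [DecidableEq n]
    (U : Matrix.unitaryGroup n ℂ) (v w : n → ℂ) :
    star ((U : Matrix n n ℂ).mulVec v) ⬝ᵥ (U : Matrix n n ℂ).mulVec w = star v ⬝ᵥ w := by
  rw [Matrix.star_mulVec, Matrix.dotProduct_mulVec, Matrix.vecMul_vecMul,
    ← Matrix.star_eq_conjTranspose, Matrix.UnitaryGroup.star_mul_self, Matrix.vecMul_one]

/-- The unitary preserves the inner product of the two initial vectors on input 0. Afterwards the
output register kills the cross terms, leaving one term per output: a product of two amplitudes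
times an overlap of ancilla states, which has modulus at most 1. -/
theorem norm_inner_state_le (hpq : (p : ℝ) + (q : ℝ) ≠ 1) (M : (labelProcess p q).QuantumModel) :
    ‖inner ℂ (M.state (causalStateEquiv hpq 0)) (M.state (causalStateEquiv hpq 1))‖ ≤
      maxOverlap p q := by
  have h := star_mulVec_dotProduct_mulVec M.U
    (IOProcess.productVec (M.state (causalStateEquiv hpq 0)) (0 : Fin 2) M.blankOut
        (EuclideanSpace.single M.blankAnc 1))
    (IOProcess.productVec (M.state (causalStateEquiv hpq 1)) (0 : Fin 2) M.blankOut
        (EuclideanSpace.single M.blankAnc 1))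
  simp only [M.evolve, sum_sqrt_transition_smul] at h
  have hself (i) : inner ℂ (M.state i) (M.state i) = (1 : ℂ) := by
    simp [inner_self_eq_norm_sq_to_K, M.state_norm]
  have hj (i j x y) : ‖inner ℂ (M.junk i x y) (M.junk j x y)‖ ≤ 1 := by
    simpa [M.junk_norm] using norm_inner_le_norm (𝕜 := ℂ) (M.junk i x y) (M.junk j x y)
  simp only [Fin.sum_univ_two, star_add, star_smul, add_dotProduct, dotProduct_add, smul_dotProduct,
    dotProduct_smul, star_productVec_dotProduct, hself, labelProb] at h
  simp at h
  rw [← h, maxOverlap]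
  refine (norm_add_le _ _).trans ?_
  simp only [norm_mul, Complex.norm_real, Real.norm_eq_abs, abs_of_nonneg (Real.sqrt_nonneg _)]
  rw [mul_left_comm, ← mul_assoc, mul_left_comm, ← mul_assoc (√(p : ℝ))]
  exact add_le_add (mul_le_of_le_one_right (by positivity) (hj _ _ _ _))
    (mul_le_of_le_one_right (by positivity) (hj _ _ _ _))

/-- This is cos² + sin² = 1 for the angle between the unit vectors (√(1-p), √p) and (√q, √(1-q)) of
output amplitudes. -/
theorem maxOverlap_sq_add (p q : unitInterval) :
    maxOverlap p q ^ 2 + (√(1 - p) * √(1 - q) - √p * √q) ^ 2 = 1 := by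
  have h1 := Real.sq_sqrt p.2.1
  have h2 := Real.sq_sqrt q.2.1
  have h3 := Real.sq_sqrt (sub_nonneg.2 p.2.2)
  have h4 := Real.sq_sqrt (sub_nonneg.2 q.2.2)
  have : maxOverlap p q ^ 2 + (√(1 - p) * √(1 - q) - √p * √q) ^ 2 =
      (√(1 - p) ^ 2 + √p ^ 2) * (√q ^ 2 + √(1 - q) ^ 2) := by rw [maxOverlap]; ring
  rw [this, h1, h2, h3, h4]; ring

/-! ### The optimal model -/

theorem exists_unitary_mulVec_single {ι κ : Type*} [Fintype ι] [DecidableEq ι] [DecidableEq κ]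
    {f : κ → ι} (hf : Function.Injective f) (w : κ → ι → ℂ)
    (hw : ∀ k l, star (w k) ⬝ᵥ w l = if k = l then 1 else 0) :
    ∃ U : Matrix.unitaryGroup ι ℂ, ∀ k, (U : Matrix ι ι ℂ).mulVec (Pi.single (f k) 1) = w k := by
  -- The value 0 off the range of `f` is never used: only the restriction to the range is extended
  -- to an orthonormal basis.
  let v : ι → EuclideanSpace ℂ ι := fun i => WithLp.toLp 2 (Function.extend f w 0 i)
  have hv (k) : v (f k) = WithLp.toLp 2 (w k) := by simp [v, hf.extend_apply]
  have hon : Orthonormal ℂ ((Set.range f).domRestrict v) := by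
    rw [orthonormal_iff_ite]
    rintro ⟨_, k, rfl⟩ ⟨_, l, rfl⟩
    simp only [Set.domRestrict_apply, hv, EuclideanSpace.inner_eq_star_dotProduct,
      dotProduct_comm _ (star _),
      hw]
    exact if_congr ⟨fun h => Subtype.ext (congrArg f h),
      fun h => hf (congrArg Subtype.val h)⟩ rfl rfl
  obtain ⟨b, hb⟩ := hon.exists_orthonormalBasis_extension_of_card_eq (by simp)
  refine ⟨⟨_, (EuclideanSpace.basisFun ι ℂ).toMatrix_orthonormalBasis_mem_unitary b⟩, fun k => ?_⟩
  rw [Matrix.mulVec_single_one]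
  ext i
  simp [Module.Basis.toMatrix_apply, hb _ ⟨k, rfl⟩, hv]

/-- The memory states of the optimal model. -/
def optimalState (p q : unitInterval) (a : Fin 2) : EuclideanSpace ℂ (Fin 2) :=
  if a = 0 then !₂[1, 0]
  else !₂[(maxOverlap p q : ℂ), ((√(1 - p) * √(1 - q) - √p * √q : ℝ) : ℂ)]

theorem norm_optimalState (p q : unitInterval) (a : Fin 2) : ‖optimalState p q a‖ = 1 := by
  unfold optimalState
  split_ifs
  · simp [EuclideanSpace.norm_eq]
  · rw [EuclideanSpace.norm_eq, Real.sqrt_eq_one, Fin.sum_univ_two]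
    refine Eq.trans ?_ (maxOverlap_sq_add p q)
    simp only [Matrix.cons_val_zero, Matrix.cons_val_one, Matrix.cons_val_fin_one,
      Complex.norm_real, Real.norm_eq_abs, sq_abs]

theorem inner_optimalState (p q : unitInterval) :
    inner ℂ (optimalState p q 0) (optimalState p q 1) = (maxOverlap p q : ℂ) := by
  simp [optimalState, PiLp.inner_apply]

open IOProcess in
/-- Images of `|a⟩|x⟩|0⟩|0⟩` under the unitary of the optimal model. -/
def optimalImage (p q : unitInterval) (k : Fin 2 × Fin 2) :
    Fin 2 × Fin 2 × Fin 2 × Fin 2 → ℂ :=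
  if k.2 = 0 then
    ∑ y, ((!![√(1 - p), √p; -√p, √(1 - p)] k.1 y : ℝ) : ℂ) •
      productVec (optimalState p q y) 0 y (EuclideanSpace.single 0 1)
  else productVec (optimalState p q 0) 1 0 (EuclideanSpace.single k.1 1)

/-- Different inputs are separated by the input register. On input 0 the output register reduces the
claim to orthonormality of the rows of a rotation; on input 1 the ancilla stores the basis label. -/
theorem star_optimalImage_dotProduct (p q : unitInterval) (k l : Fin 2 × Fin 2) :
    star (optimalImage p q k) ⬝ᵥ optimalImage p q l = if k = l then 1 else 0 := by
  have h1 : (√(p : ℝ) : ℂ) * √(p : ℝ) = p := by exact_mod_cast Real.mul_self_sqrt p.2.1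
  have h2 : (√(1 - p : ℝ) : ℂ) * √(1 - p : ℝ) = 1 - p := by
    exact_mod_cast Real.mul_self_sqrt (sub_nonneg.2 p.2.2)
  obtain ⟨a, x⟩ := k
  obtain ⟨b, x'⟩ := l
  fin_cases x <;> fin_cases x' <;> fin_cases a <;> fin_cases b <;>
    simp [optimalImage, Fin.sum_univ_two, add_dotProduct, dotProduct_add,
      star_productVec_dotProduct, norm_optimalState, EuclideanSpace.inner_single_left] <;>
    first
      | linear_combination h1 + h2
      | ring

-- The coordinates of `optimalState p q 1` are those of (√q, √(1-q)) in the rotated basis (√(1-p),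
-- √p), (-√p, √(1-p)), so linearity gives the right amplitudes on input 0. On input 1 the memory is
-- reset, and the ancilla must take over the old state to preserve the overlap.
open IOProcess in
theorem exists_optimal_unitary (p q : unitInterval) :
    ∃ U : Matrix.unitaryGroup (Fin 2 × Fin 2 × Fin 2 × Fin 2) ℂ, ∀ a x : Fin 2,
      (U : Matrix (Fin 2 × Fin 2 × Fin 2 × Fin 2) _ ℂ).mulVec
          (productVec (optimalState p q a) x (0 : Fin 2) (EuclideanSpace.single (0 : Fin 2) 1)) =
        ∑ y, ((√(labelProb p q a x y) : ℝ) : ℂ) • productVec (optimalState p q y) x y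
          (if x = 0 then EuclideanSpace.single 0 1 else optimalState p q a) := by
  obtain ⟨U, hU⟩ := exists_unitary_mulVec_single
    (f := fun k : Fin 2 × Fin 2 => ((k.1, k.2, 0, 0) : Fin 2 × Fin 2 × Fin 2 × Fin 2))
    (fun k l h => by simpa [Prod.ext_iff] using h) _ (star_optimalImage_dotProduct p q)
  refine ⟨U, fun a x => ?_⟩
  have hdecomp : productVec (optimalState p q a) x (0 : Fin 2) (EuclideanSpace.single 0 1) =
      ∑ b, optimalState p q a b • Pi.single (b, x, (0 : Fin 2), (0 : Fin 2)) (1 : ℂ) := by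
    ext ⟨b, x', y, c⟩
    simp only [productVec, Fin.sum_univ_two, Pi.add_apply, Pi.smul_apply, Pi.single_apply,
      Prod.mk.injEq]
    fin_cases b <;> simp [ite_and] <;> split_ifs <;> rfl
  have hlin : (U : Matrix (Fin 2 × Fin 2 × Fin 2 × Fin 2) _ ℂ).mulVec
      (productVec (optimalState p q a) x (0 : Fin 2) (EuclideanSpace.single (0 : Fin 2) 1)) =
      ∑ b, optimalState p q a b • optimalImage p q (b, x) := by
    simp only [hdecomp, Matrix.mulVec_sum, Matrix.mulVec_smul, ← hU]
  have h00 : optimalState p q 0 0 = 1 := by simp [optimalState]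
  have h01 : optimalState p q 0 1 = 0 := by simp [optimalState]
  have h10 : optimalState p q 1 0 = maxOverlap p q := by simp [optimalState]
  have h11 : optimalState p q 1 1 = (√(1 - p) * √(1 - q) - √p * √q : ℝ) := by
    simp [optimalState]
  have h1 : (√(p : ℝ) : ℂ) ^ 2 = p := by exact_mod_cast Real.sq_sqrt p.2.1
  have h2 : (√(1 - p : ℝ) : ℂ) ^ 2 = 1 - p := by
    exact_mod_cast Real.sq_sqrt (sub_nonneg.2 p.2.2)
  rw [hlin]
  fin_cases a <;> fin_cases x
  · simp [optimalImage, labelProb, h00, h01]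
  · ext ⟨b, x, y, c⟩
    fin_cases c <;> fin_cases y <;> simp [optimalImage, labelProb, h00, h01, productVec]
  · simp [optimalImage, labelProb, h10, h11, maxOverlap]
    match_scalars
    · linear_combination (√(q : ℝ) : ℂ) * (h1 + h2)
    · linear_combination (√(1 - q : ℝ) : ℂ) * (h1 + h2)
  · ext ⟨b, x, y, c⟩
    fin_cases c <;> fin_cases y <;>
      simp [optimalImage, labelProb, h10, h11, productVec, mul_comm]

/-- The quantum model whose memory states have the largest possible overlap. -/
def optimalModel (hpq : (p : ℝ) + (q : ℝ) ≠ 1) : (labelProcess p q).QuantumModel where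
  memDim := 2
  ancDim := 2
  state i := optimalState p q ((causalStateEquiv hpq).symm i)
  state_norm _ := norm_optimalState _ _ _
  blankOut := 0
  blankAnc := 0
  junk i x _ := if x = 0 then EuclideanSpace.single 0 1
    else optimalState p q ((causalStateEquiv hpq).symm i)
  junk_norm i x y := by split_ifs <;> simp [norm_optimalState]
  U := (exists_optimal_unitary p q).choose
  evolve i x := by
    obtain ⟨a, rfl⟩ := (causalStateEquiv hpq).surjective i
    rw [Equiv.symm_apply_apply, (exists_optimal_unitary p q).choose_spec]
    exact Finset.sum_congr rfl fun y _ => by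
      rw [sum_sqrt_transition_smul, Equiv.symm_apply_apply]

theorem norm_inner_optimalModel_state (hpq : (p : ℝ) + (q : ℝ) ≠ 1) :
    ‖inner ℂ ((optimalModel hpq).state (causalStateEquiv hpq 0))
      ((optimalModel hpq).state (causalStateEquiv hpq 1))‖ = maxOverlap p q := by
  have : 0 ≤ maxOverlap p q := by unfold maxOverlap; positivity
  have h (a) : (optimalModel hpq).state (causalStateEquiv hpq a) = optimalState p q a :=
    congrArg (optimalState p q) ((causalStateEquiv hpq).symm_apply_apply a)
  exact (congrArg norm ((congrArg₂ (inner ℂ) (h 0) (h 1)).trans (inner_optimalState p q))).trans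
    (by rw [Complex.norm_real, Real.norm_of_nonneg this])

/-! ### Optimality and comparison of the complexities -/

/-- The sine in `maxOverlap_sq_add` vanishes only if (1-p)(1-q) = pq, that is, p + q = 1. -/
theorem maxOverlap_sq_lt_one (hpq : (p : ℝ) + (q : ℝ) ≠ 1) : maxOverlap p q ^ 2 < 1 := by
  rw [← maxOverlap_sq_add p q]
  refine lt_add_of_pos_right _ (sq_pos_of_ne_zero (sub_ne_zero.2 fun h => hpq ?_))
  rw [← Real.sqrt_mul (sub_nonneg.2 p.2.2), ← Real.sqrt_mul p.2.1, Real.sqrt_inj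
    (mul_nonneg (sub_nonneg.2 p.2.2) (sub_nonneg.2 q.2.2)) (mul_nonneg p.2.1 q.2.1)] at h
  linarith

/-- Keeps every determinant in the interval where `Real.entropyOfDet` is strictly monotone; `c = 1`
is the classical case. -/
theorem weight_mem (hpq : (p : ℝ) + (q : ℝ) ≠ 1)
    (hπ : π ∈ stdSimplex ℝ (labelProcess p q).CausalState) {c : ℝ} (hc : 0 ≤ c) (hc1 : c ≤ 1) :
    π (causalStateEquiv hpq 0) * π (causalStateEquiv hpq 1) * c ∈ Set.Icc (0 : ℝ) 4⁻¹ := by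
  have h := mul_nonneg (hπ.1 (causalStateEquiv hpq 0)) (hπ.1 (causalStateEquiv hpq 1))
  refine ⟨mul_nonneg h hc, (mul_le_of_le_one_right h hc1).trans ?_⟩
  rw [eq_sub_of_add_eq (add_eq_one_of_mem_stdSimplex hpq hπ)]
  nlinarith [sq_nonneg (1 - 2 * π (causalStateEquiv hpq 1))]

theorem optimalModel_complexity_le (hpq : (p : ℝ) + (q : ℝ) ≠ 1)
    (hπ : π ∈ stdSimplex ℝ (labelProcess p q).CausalState) (M : (labelProcess p q).QuantumModel) :
    (optimalModel hpq).complexity π ≤ M.complexity π := by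
  have hle := pow_le_pow_left₀ (norm_nonneg _) (norm_inner_state_le hpq M) 2
  have h1 := maxOverlap_sq_lt_one hpq
  rw [quantumModel_complexity_eq hpq hπ, quantumModel_complexity_eq hpq hπ,
    norm_inner_optimalModel_state]
  refine Real.strictMonoOn_entropyOfDet.monotoneOn (weight_mem hpq hπ ?_ ?_)
    (weight_mem hpq hπ ?_ ?_) (mul_le_mul_of_nonneg_left (by linarith) ?_)
  · linarith
  · linarith [sq_nonneg (maxOverlap p q)]
  · linarith
  · linarith [sq_nonneg ‖inner ℂ (M.state (causalStateEquiv hpq 0))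
          (M.state (causalStateEquiv hpq 1))‖]
  · exact mul_nonneg (hπ.1 _) (hπ.1 _)

theorem quantumComplexity_eq (hpq : (p : ℝ) + (q : ℝ) ≠ 1)
    (hπ : π ∈ stdSimplex ℝ (labelProcess p q).CausalState) :
    (labelProcess p q).quantumComplexity π = (optimalModel hpq).complexity π :=
  have : Nonempty (labelProcess p q).QuantumModel := ⟨optimalModel hpq⟩
  le_antisymm (ciInf_le ⟨_, Set.forall_mem_range.2 (optimalModel_complexity_le hpq hπ)⟩ _)
    (le_ciInf (optimalModel_complexity_le hpq hπ))

theorem quantumComplexity_eq_entropyOfDet (hpq : (p : ℝ) + (q : ℝ) ≠ 1)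
    (hπ : π ∈ stdSimplex ℝ (labelProcess p q).CausalState) :
    (labelProcess p q).quantumComplexity π =
      Real.entropyOfDet (π (causalStateEquiv hpq 0) * π (causalStateEquiv hpq 1) *
        (1 - maxOverlap p q ^ 2)) := by
  rw [quantumComplexity_eq hpq hπ, quantumModel_complexity_eq hpq hπ,
    norm_inner_optimalModel_state]

end labelProcess
end

theorem mainTheorem11 (p q : unitInterval)
    (hp : 0 < (p : ℝ) ∧ (p : ℝ) < 1) (hq : 0 < (q : ℝ) ∧ (q : ℝ) < 1)
    (hpq : (p : ℝ) + (q : ℝ) ≠ 1) :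
    -- there are exactly two causal states
    Fintype.card (labelProcess p q).CausalState = 2 ∧
    -- each biased coin drives the process to a unique stationary distribution
    (∀ r ∈ Set.Icc (0 : ℝ) 1,
      ∃! π : (labelProcess p q).CausalState → ℝ,
        (labelProcess p q).IsStationary (biasedCoin r) π) ∧
    -- some quantum model is optimal, for all biased coins simultaneously
    (∃ M : (labelProcess p q).QuantumModel,
      ∀ r ∈ Set.Icc (0 : ℝ) 1, ∀ π, (labelProcess p q).IsStationary (biasedCoin r) π →
        (labelProcess p q).quantumComplexity π = M.complexity π ∧
        ∀ M' : (labelProcess p q).QuantumModel, M.complexity π ≤ M'.complexity π) ∧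
    -- the classical and quantum complexities differ
    (∀ r ∈ Set.Ioc (0 : ℝ) 1, ∀ π, (labelProcess p q).IsStationary (biasedCoin r) π →
      (labelProcess p q).quantumComplexity π < (labelProcess p q).classicalComplexity π) ∧
    -- the two complexities order every pair of biased coins in the same way
    (∀ r ∈ Set.Icc (0 : ℝ) 1, ∀ r' ∈ Set.Icc (0 : ℝ) 1, ∀ π π',
      (labelProcess p q).IsStationary (biasedCoin r) π →
      (labelProcess p q).IsStationary (biasedCoin r') π' →
      ((labelProcess p q).classicalComplexity π < (labelProcess p q).classicalComplexity π' ↔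
        (labelProcess p q).quantumComplexity π < (labelProcess p q).quantumComplexity π')) := by
  have mem {r : ℝ} {π} (h : (labelProcess p q).IsStationary (biasedCoin r) π) := h.1
  have hlt := labelProcess.maxOverlap_sq_lt_one hpq
  have hsq := sq_nonneg (labelProcess.maxOverlap p q)
  have hw {π} (hπ : π ∈ stdSimplex ℝ (labelProcess p q).CausalState) :=
    mul_one (π (labelProcess.causalStateEquiv hpq 0) * π (labelProcess.causalStateEquiv hpq 1)) ▸
      labelProcess.weight_mem hpq hπ zero_le_one le_rfl
  refine ⟨?_, fun r hr => labelProcess.existsUnique_isStationary hpq hr hq.1,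
    ⟨labelProcess.optimalModel hpq, fun r _ π hπ =>
      ⟨labelProcess.quantumComplexity_eq hpq hπ.1,
        labelProcess.optimalModel_complexity_le hpq hπ.1⟩⟩, ?_, ?_⟩
  · simpa using (Fintype.card_congr (labelProcess.causalStateEquiv hpq)).symm
  · intro r hr π hπ
    rw [labelProcess.quantumComplexity_eq_entropyOfDet hpq hπ.1,
      labelProcess.classicalComplexity_eq hpq hπ.1]
    refine Real.strictMonoOn_entropyOfDet
      (labelProcess.weight_mem hpq hπ.1 (by linarith) (by linarith)) (hw hπ.1) ?_
    -- Strictness needs both weights positive, hence r > 0, and a nonzero overlap.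
    have hpos := labelProcess.isStationary_pos hpq hr hp.1 hq.1 hπ
    have hov : 0 < labelProcess.maxOverlap p q :=
      add_pos (mul_pos (Real.sqrt_pos.2 (sub_pos.2 hp.2)) (Real.sqrt_pos.2 hq.1))
        (mul_pos (Real.sqrt_pos.2 hp.1) (Real.sqrt_pos.2 (sub_pos.2 hq.2)))
    exact mul_lt_of_lt_one_right (mul_pos (hpos 0) (hpos 1)) (sub_lt_self 1 (pow_pos hov 2))
  · intro r _ r' _ π π' hπ hπ'
    rw [labelProcess.quantumComplexity_eq_entropyOfDet hpq hπ.1,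
      labelProcess.quantumComplexity_eq_entropyOfDet hpq hπ'.1,
      labelProcess.classicalComplexity_eq hpq hπ.1, labelProcess.classicalComplexity_eq hpq hπ'.1,
      -- Both comparisons become comparisons of determinants, which differ by the common positive
      -- factor 1 - `maxOverlap`².
      Real.strictMonoOn_entropyOfDet.lt_iff_lt (hw hπ.1) (hw hπ'.1),
      Real.strictMonoOn_entropyOfDet.lt_iff_lt
        (labelProcess.weight_mem hpq hπ.1 (by linarith) (by linarith))
        (labelProcess.weight_mem hpq hπ'.1 (by linarith) (by linarith)),
      mul_lt_mul_iff_left₀ (sub_pos.2 hlt)]
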